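/- Let $n\le m$, let $\mu=\mathcal N(m_0,\Sigma_0)$ be a Gaussian measure on $\mathbb R^m$ with non-singular covariance matrix $\Sigma_0$, and let $\nu=\mathcal N(m_1,\Sigma_1)$ be a (possibly degenerate) Gaussian measure on $\mathbb R^n$. Let $\Sigma_0=P_0D_0P_0^T$ and $\Sigma_1=P_1D_1P_1^T$ be diagonalizations with $P_0,P_1$ orthogonal and $D_0,D_1$ diagonal with diagonal entries in decreasing (non-increasing) order. Write $\|M\|_{\mathcal F}=\sqrt{\operatorname{tr}(M^TM)}$ for the Frobenius norm and $D_0^{(n)}$ for the submatrix of $D_0$ formed by its first $n$ rows and first $n$ columns. Let $$GW_2^2(\mu,\nu)=\inf_{\pi\in\Pi(\mu,\nu)}\int\!\!\int\left(\|x-x'\|_{\mathbb R^m}^2-\|y-y'\|_{\mathbb R^n}^2\right)^2\,d\pi(x,y)\,d\pi(x',y'),$$ where $\Pi(\mu,\nu)$ is the set of measures on $\mathbb R^m\times\mathbb R^n$ with marginals $\mu$ and $\nu$. Then $$GW_2^2(\mu,\nu)\ \ge\ LGW_2^2(\mu,\nu),$$ where $$LGW_2^2(\mu,\nu)=4\left(\operatorname{tr}D_0-\operatorname{tr}D_1\right)^2+4\left(\|D_0\|_{\mathcal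 F}-\|D_1\|_{\mathcal F}\right)^2+4\left\|D_0^{(n)}-D_1\right\|_{\mathcal F}^2+4\left(\|D_0\|_{\mathcal F}^2-\|D_0^{(n)}\|_{\mathcal F}^2\right).$$ -/

import Mathlib

open MeasureTheory ProbabilityTheory Matrix
open scoped ENNReal

namespace GromovGaussian

/-- The set `Π(μ, ν)` of measures on `X × Y` with marginals `μ` and `ν`. -/
def couplings {X Y : Type*} [MeasurableSpace X] [MeasurableSpace Y]
    (μ : Measure X) (ν : Measure Y) : Set (Measure (X × Y)) :=
  {π | π.map Prod.fst = μ ∧ π.map Prod.snd = ν}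

/-- The Gromov-Wasserstein cost `GW_p(c_X, c_Y, μ, ν)`, with values in `[0, ∞]`:
the `p`-th root of the infimum over the couplings `π` of
`∫ |c_X(x, x') - c_Y(y, y')| ^ p dπ(x, y) dπ(x', y')`. -/
noncomputable def gromovWasserstein {X Y : Type*} [MeasurableSpace X] [MeasurableSpace Y]
    (p : ℝ) (cX : X → X → ℝ) (cY : Y → Y → ℝ) (μ : Measure X) (ν : Measure Y) : ℝ≥0∞ :=
  (⨅ π ∈ couplings μ ν,
    ∫⁻ z, ∫⁻ z', ENNReal.ofReal (|cX z.1 z'.1 - cY z.2 z'.2| ^ p) ∂π ∂π) ^ (1 / p)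

/-- `GW₂(μ, ν)` for measures on Euclidean spaces, with the squared Euclidean distances as costs. -/
noncomputable def GW₂ {m n : ℕ} (μ : Measure (EuclideanSpace ℝ (Fin m)))
    (ν : Measure (EuclideanSpace ℝ (Fin n))) : ℝ≥0∞ :=
  gromovWasserstein 2 (fun x x' => ‖x - x'‖ ^ 2) (fun y y' => ‖y - y'‖ ^ 2) μ ν

/-- `S = P D Pᵀ` with `P` orthogonal and `D` diagonal, the diagonal entries of `D` (the eigenvalues
of `S`) being in decreasing order. -/
structure IsSortedDiagonalization {k : ℕ} (S P D : Matrix (Fin k) (Fin k) ℝ) : Prop where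
  orthogonal : P ∈ Matrix.orthogonalGroup (Fin k) ℝ
  isDiag : D.IsDiag
  sorted : Antitone fun i => D i i
  eq : S = P * D * Pᵀ

/-- The Frobenius norm `√(tr(Mᵀ M))`. -/
noncomputable def frobNorm {k l : ℕ} (M : Matrix (Fin k) (Fin l) ℝ) : ℝ :=
  Real.sqrt (Mᵀ * M).trace

/-- The submatrix `A^{(n)}` of the first `n` rows and columns of an `m × m` matrix, `n ≤ m`. -/
def leading {m n : ℕ} (hnm : n ≤ m) (A : Matrix (Fin m) (Fin m) ℝ) : Matrix (Fin n) (Fin n) ℝ :=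
  A.submatrix (Fin.castLE hnm) (Fin.castLE hnm)

/-- The quantity `LGW₂²`, in terms of the two sorted diagonal matrices of eigenvalues. -/
noncomputable def LGW₂sq {m n : ℕ} (hnm : n ≤ m) (D₀ : Matrix (Fin m) (Fin m) ℝ)
    (D₁ : Matrix (Fin n) (Fin n) ℝ) : ℝ :=
  4 * (D₀.trace - D₁.trace) ^ 2 + 4 * (frobNorm D₀ - frobNorm D₁) ^ 2
    + 4 * frobNorm (leading hnm D₀ - D₁) ^ 2
    + 4 * (frobNorm D₀ ^ 2 - frobNorm (leading hnm D₀) ^ 2)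

end GromovGaussian

/-!
The infimum defining `GW₂²` is bounded below coupling by coupling. Let `π` be a coupling, let `X` be
the coordinates of `x - m₀` in the basis given by the columns of `P₀` and `Y` those of `y - m₁` in
the basis given by the columns of `P₁`. Then `X` and `Y` are centred Gaussian vectors with
covariances `D₀ = diag a` and `D₁ = diag b`, and distances are unchanged. With
`p = ‖X‖² - ‖Y‖²` and an independent copy `(X', Y')` of `(X, Y)`, the integrand is
`(p + p' - 2 (⟨X, X'⟩ - ⟨Y, Y'⟩))²`, and centring kills the odd terms, so that
(`integrable_integral_signed_sq_dist`) its integral is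

  `2 E p² + 2 (E p)² + 4 (∑ aᵢ² + ∑ bⱼ² - 2 ∑ Kᵢⱼ²)`, where `Kᵢⱼ = E Xᵢ Yⱼ`.

Here `E p = tr D₀ - tr D₁`, and `E p² = (E p)² + Var p`; only two terms depend on the coupling.

* `Var p ≥ (√Var ‖X‖² - √Var ‖Y‖²)²` by Cauchy-Schwarz (`sq_sqrt_variance_sub_le`), and
  `Var ‖X‖² = 2 ∑ aᵢ²`, since the `Xᵢ` are independent and a centred Gaussian variable of variance
  `v` has fourth moment `3 v²` (`variance_sum_sq_of_hasGaussianLaw`).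
* `∑ Kᵢⱼ² ≤ ∑ⱼ aⱼ bⱼ` (`sum_sq_crossCov_le`): by Bessel's inequality the matrix `Kᵢⱼ² / (aᵢ bⱼ)` has
  row and column sums at most `1`, and for such a matrix the rearrangement inequality
  `sum_mul_le_of_substochastic` holds, by linear programming duality.

The sum of these bounds is `LGW₂²` (`LGW₂sq_diagonal`).
-/

namespace GromovGaussian

/-! ### A rearrangement inequality -/

/-- A feasible point of the dual of the transport problem with profit `A i * B j`, with value the
profit of the diagonal assignment. The potentials are the two halves of the summation by parts of
`A k * B k`. -/
lemma exists_dual_potentials {A B : ℕ → ℝ} (hA : Antitone A) (hB : Antitone B)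
    (hA0 : ∀ k, 0 ≤ A k) (hB0 : ∀ k, 0 ≤ B k) {n N : ℕ} (hBn : ∀ k, n ≤ k → B k = 0)
    (hn : n ≤ N) :
    ∃ U V : ℕ → ℝ, (∀ k, 0 ≤ U k) ∧ (∀ k, 0 ≤ V k) ∧ (∀ k, n ≤ k → U k = 0) ∧
      (∀ k ≤ N, U k + V k = A k * B k) ∧ ∀ i ≤ N, ∀ j ≤ N, A i * B j ≤ U i + V j := by
  have hdA (k : ℕ) : 0 ≤ A k - A (k + 1) := sub_nonneg.2 (hA k.le_succ)
  have hdB (k : ℕ) : 0 ≤ B k - B (k + 1) := sub_nonneg.2 (hB k.le_succ)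
  set U : ℕ → ℝ := fun i ↦ ∑ k ∈ Finset.Ico i N, B k * (A k - A (k + 1)) with hU
  set V : ℕ → ℝ := fun j ↦ ∑ k ∈ Finset.Ico j N, A (k + 1) * (B k - B (k + 1)) with hV
  have hUV (k : ℕ) (hk : k ≤ N) : U k + V k = A k * B k := by
    have h (l : ℕ) : B l * (A l - A (l + 1)) + A (l + 1) * (B l - B (l + 1)) =
        -(A (l + 1) * B (l + 1) - A l * B l) := by ring
    simp only [hU, hV]
    rw [← Finset.sum_add_distrib, Finset.sum_congr rfl fun l _ ↦ h l, Finset.sum_neg_distrib,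
      Finset.sum_Ico_sub (fun l ↦ A l * B l) hk, hBn N hn]
    ring
  refine ⟨U, V, fun k ↦ Finset.sum_nonneg fun l _ ↦ mul_nonneg (hB0 _) (hdA _),
    fun k ↦ Finset.sum_nonneg fun l _ ↦ mul_nonneg (hA0 _) (hdB _),
    fun k hk ↦ Finset.sum_eq_zero fun l hl ↦ ?_, hUV, fun i hi j hj ↦ ?_⟩
  · rw [hBn l (hk.trans (Finset.mem_Ico.1 hl).1), zero_mul]
  rcases le_total i j with hij | hij
  · have h1 : U i = ∑ k ∈ Finset.Ico i j, B k * (A k - A (k + 1)) + U j :=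
      (Finset.sum_Ico_consecutive _ hij hj).symm
    have h2 : ∑ k ∈ Finset.Ico i j, B j * (-(A (k + 1) - A k)) ≤
        ∑ k ∈ Finset.Ico i j, B k * (A k - A (k + 1)) := by
      refine Finset.sum_le_sum fun k hk ↦ ?_
      rw [neg_sub]
      exact mul_le_mul_of_nonneg_right (hB (Finset.mem_Ico.1 hk).2.le) (hdA k)
    rw [← Finset.mul_sum, Finset.sum_neg_distrib, Finset.sum_Ico_sub A hij] at h2
    linarith [hUV j hj]
  · have h1 : V j = ∑ k ∈ Finset.Ico j i, A (k + 1) * (B k - B (k + 1)) + V i :=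
      (Finset.sum_Ico_consecutive _ hij hi).symm
    have h2 : ∑ k ∈ Finset.Ico j i, A i * (-(B (k + 1) - B k)) ≤
        ∑ k ∈ Finset.Ico j i, A (k + 1) * (B k - B (k + 1)) := by
      refine Finset.sum_le_sum fun k hk ↦ ?_
      rw [neg_sub]
      exact mul_le_mul_of_nonneg_right (hA (Finset.mem_Ico.1 hk).2) (hdB k)
    rw [← Finset.mul_sum, Finset.sum_neg_distrib, Finset.sum_Ico_sub B hij] at h2
    linarith [hUV i hi]

/-- The extension by zero of a finite sequence. -/
def extendZero {k : ℕ} (a : Fin k → ℝ) (i : ℕ) : ℝ := if h : i < k then a ⟨i, h⟩ else 0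

lemma extendZero_val {k : ℕ} (a : Fin k → ℝ) (i : Fin k) : extendZero a i = a i := by
  simp [extendZero]

lemma extendZero_nonneg {k : ℕ} {a : Fin k → ℝ} (ha : ∀ i, 0 ≤ a i) (i : ℕ) :
    0 ≤ extendZero a i := by
  unfold extendZero; split_ifs <;> simp [ha]

lemma extendZero_antitone {k : ℕ} {a : Fin k → ℝ} (h : Antitone a) (ha : ∀ i, 0 ≤ a i) :
    Antitone (extendZero a) := by
  intro i j hij
  by_cases hj : j < k
  · simpa [extendZero, hj, hij.trans_lt hj] using h (Fin.mk_le_mk.2 hij)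
  · rw [extendZero, dif_neg hj]
    exact extendZero_nonneg ha i

/-- Weak duality: pairing a doubly substochastic matrix with the potentials of
`exists_dual_potentials` bounds its profit by that of the diagonal assignment. -/
lemma sum_mul_le_of_substochastic {m n : ℕ} (hnm : n ≤ m) {a : Fin m → ℝ} {b : Fin n → ℝ}
    (ha : Antitone a) (hb : Antitone b) (ha0 : ∀ i, 0 ≤ a i) (hb0 : ∀ j, 0 ≤ b j)
    {M : Fin m → Fin n → ℝ} (hM : ∀ i j, 0 ≤ M i j) (hrow : ∀ i, ∑ j, M i j ≤ 1)
    (hcol : ∀ j, ∑ i, M i j ≤ 1) :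
    ∑ i, ∑ j, a i * b j * M i j ≤ ∑ j, a (Fin.castLE hnm j) * b j := by
  obtain ⟨U, V, hU0, hV0, hUn, hUV, hle⟩ := exists_dual_potentials
    (extendZero_antitone ha ha0) (extendZero_antitone hb hb0) (extendZero_nonneg ha0)
    (extendZero_nonneg hb0) (n := n) (N := m)
    (fun k hk ↦ by simp [extendZero, hk.not_gt]) hnm
  calc ∑ i, ∑ j, a i * b j * M i j
      ≤ ∑ i : Fin m, ∑ j : Fin n, (U i + V j) * M i j := by
        refine Finset.sum_le_sum fun i _ ↦ Finset.sum_le_sum fun j _ ↦ ?_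
        have := hle i i.2.le j (j.2.le.trans hnm)
        rw [extendZero_val, extendZero_val] at this
        exact mul_le_mul_of_nonneg_right this (hM i j)
    _ = ∑ i : Fin m, U i * ∑ j, M i j + ∑ j : Fin n, V j * ∑ i, M i j := by
        simp_rw [add_mul, Finset.sum_add_distrib, Finset.mul_sum]
        congr 1
        exact Finset.sum_comm
    _ ≤ ∑ i : Fin m, U i + ∑ j : Fin n, V j :=
        add_le_add (Finset.sum_le_sum fun i _ ↦ mul_le_of_le_one_right (hU0 _) (hrow i))
          (Finset.sum_le_sum fun j _ ↦ mul_le_of_le_one_right (hV0 _) (hcol j))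
    _ = ∑ j : Fin n, (U j + V j) := by
        rw [Finset.sum_add_distrib, Fin.sum_univ_eq_sum_range (fun i ↦ U i) m,
          Fin.sum_univ_eq_sum_range (fun i ↦ U i) n]
        congr 1
        refine (Finset.sum_subset (Finset.range_mono hnm) fun k _ hk ↦ hUn k ?_).symm
        simpa using hk
    _ = ∑ j, a (Fin.castLE hnm j) * b j := by
        refine Finset.sum_congr rfl fun j _ ↦ ?_
        rw [hUV j (j.2.le.trans hnm), extendZero_val, ← extendZero_val a (Fin.castLE hnm j)]
        rfl

/-! ### The cross-covariance bound -/

/-- Bessel's inequality, for a quadratic form with diagonal `a`. Indices with `a i = 0` contribute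
nothing to the left side, as division by zero yields zero. -/
lemma sum_sq_div_le {ι : Type*} [Fintype ι] {a k : ι → ℝ} {β : ℝ}
    (h : ∀ s : ι → ℝ, 0 ≤ ∑ i, s i ^ 2 * a i - 2 * ∑ i, s i * k i + β) :
    ∑ i, k i ^ 2 / a i ≤ β := by
  -- the minimiser of the quadratic form
  have h1 := h fun i ↦ k i / a i
  have h2 (i : ι) : (k i / a i) ^ 2 * a i = k i ^ 2 / a i := by
    by_cases hi : a i = 0
    · simp [hi]
    · field_simp
  have h3 (i : ι) : k i / a i * k i = k i ^ 2 / a i := by ring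
  simp_rw [h2, h3] at h1
  linarith

/-- For random variables with covariances `diag a` and `diag b`, the cross-covariance `K` satisfies
the three hypotheses `hK`, `hrow` and `hcol`: they are instances of the positivity of the joint
covariance. -/
lemma sum_sq_crossCov_le {m n : ℕ} (hnm : n ≤ m) {a : Fin m → ℝ} {b : Fin n → ℝ}
    (ha : Antitone a) (hb : Antitone b) (ha0 : ∀ i, 0 ≤ a i) (hb0 : ∀ j, 0 ≤ b j)
    {K : Fin m → Fin n → ℝ} (hK : ∀ i j, K i j ^ 2 ≤ a i * b j)
    (hrow : ∀ i, ∀ t : Fin n → ℝ, 0 ≤ ∑ j, t j ^ 2 * b j - 2 * ∑ j, t j * K i j + a i)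
    (hcol : ∀ j, ∀ s : Fin m → ℝ, 0 ≤ ∑ i, s i ^ 2 * a i - 2 * ∑ i, s i * K i j + b j) :
    ∑ i, ∑ j, K i j ^ 2 ≤ ∑ j, a (Fin.castLE hnm j) * b j := by
  have hKa (i : Fin m) (j : Fin n) (h : a i = 0) : K i j = 0 :=
    pow_eq_zero_iff two_ne_zero |>.1 (le_antisymm ((hK i j).trans_eq (by simp [h])) (sq_nonneg _))
  have hKb (i : Fin m) (j : Fin n) (h : b j = 0) : K i j = 0 :=
    pow_eq_zero_iff two_ne_zero |>.1 (le_antisymm ((hK i j).trans_eq (by simp [h])) (sq_nonneg _))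
  -- degenerate directions are harmless: there `K i j` vanishes as well
  have hM (i : Fin m) (j : Fin n) : K i j ^ 2 = a i * b j * (K i j ^ 2 / (a i * b j)) := by
    by_cases hi : a i = 0
    · simp [hi, hKa]
    by_cases hj : b j = 0
    · simp [hj, hKb]
    field_simp
  rw [Finset.sum_congr rfl fun i _ ↦ Finset.sum_congr rfl fun j _ ↦ hM i j]
  refine sum_mul_le_of_substochastic hnm ha hb ha0 hb0
    (fun i j ↦ div_nonneg (sq_nonneg _) (mul_nonneg (ha0 i) (hb0 j))) (fun i ↦ ?_) (fun j ↦ ?_)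
  · have := sum_sq_div_le (hrow i)
    simp_rw [mul_comm (a i), ← div_div, ← Finset.sum_div]
    exact div_le_one_of_le₀ this (ha0 i)
  · have := sum_sq_div_le (hcol j)
    simp_rw [← div_div, ← Finset.sum_div]
    exact div_le_one_of_le₀ this (hb0 j)

/-! ### Moments of Gaussian vectors -/

section Moments

variable {Ω : Type*} [MeasurableSpace Ω] {P : Measure Ω}

lemma iteratedDeriv_four_exp_mul_sq (v : ℝ) :
    iteratedDeriv 4 (fun t : ℝ ↦ Real.exp (v * t ^ 2 / 2)) 0 = 3 * v ^ 2 := by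
  have hE (t : ℝ) : HasDerivAt (fun t : ℝ ↦ Real.exp (v * t ^ 2 / 2))
      (v * t * Real.exp (v * t ^ 2 / 2)) t := by
    have := ((((hasDerivAt_id t).pow 2).const_mul v).div_const 2).exp
    convert! this using 1
    simp; ring
  have h1 : deriv (fun t : ℝ ↦ Real.exp (v * t ^ 2 / 2)) =
      fun t ↦ v * t * Real.exp (v * t ^ 2 / 2) := funext fun t ↦ (hE t).deriv
  have h2 : deriv (fun t : ℝ ↦ v * t * Real.exp (v * t ^ 2 / 2)) =
      fun t ↦ (v + v ^ 2 * t ^ 2) * Real.exp (v * t ^ 2 / 2) := funext fun t ↦ by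
    refine HasDerivAt.deriv ?_
    convert! ((hasDerivAt_id t).const_mul v).mul (hE t) using 1
    simp; ring
  have h3 : deriv (fun t : ℝ ↦ (v + v ^ 2 * t ^ 2) * Real.exp (v * t ^ 2 / 2)) =
      fun t ↦ (3 * v ^ 2 * t + v ^ 3 * t ^ 3) * Real.exp (v * t ^ 2 / 2) := funext fun t ↦ by
    refine HasDerivAt.deriv ?_
    convert! ((((hasDerivAt_id t).pow 2).const_mul (v ^ 2)).const_add v).mul (hE t) using 1
    simp; ring
  have h4 : deriv (fun t : ℝ ↦ (3 * v ^ 2 * t + v ^ 3 * t ^ 3) * Real.exp (v * t ^ 2 / 2)) 0 =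
      3 * v ^ 2 := by
    refine HasDerivAt.deriv ?_
    convert! (((hasDerivAt_id (0 : ℝ)).const_mul (3 * v ^ 2)).add
      (((hasDerivAt_id (0 : ℝ)).pow 3).const_mul (v ^ 3))).mul (hE 0) using 1
    simp
  rw [iteratedDeriv_succ, iteratedDeriv_succ, iteratedDeriv_succ, iteratedDeriv_one, h1, h2, h3, h4]

/-- The fourth moment is the fourth derivative at `0` of the moment generating function. -/
lemma integral_pow_four_of_hasGaussianLaw {X : Ω → ℝ} (hX : HasGaussianLaw X P)
    (h0 : ∫ ω, X ω ∂P = 0) : ∫ ω, X ω ^ 4 ∂P = 3 * Var[X; P] ^ 2 := by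
  have hlaw := hX.map_eq_gaussianReal
  rw [h0] at hlaw
  have hset : integrableExpSet X P = Set.univ := by
    refine Set.eq_univ_of_forall fun t ↦ ?_
    have := integrable_exp_mul_gaussianReal (μ := 0) (v := Var[X; P].toNNReal) t
    rw [← hlaw] at this
    exact this.comp_aemeasurable hX.aemeasurable
  have h4 := iteratedDeriv_mgf_zero (X := X) (μ := P) (by simp [hset]) 4
  have hmgf : mgf X P = fun t ↦ Real.exp (Var[X; P] * t ^ 2 / 2) := by
    ext t
    rw [mgf_gaussianReal hlaw, Real.coe_toNNReal _ (variance_nonneg _ _)]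
    simp
  rw [hmgf, iteratedDeriv_four_exp_mul_sq] at h4
  simpa using h4.symm

lemma memLp_two_mul {X Y : Ω → ℝ} (hX : MemLp X 4 P) (hY : MemLp Y 4 P) :
    MemLp (fun ω ↦ X ω * Y ω) 2 P := by
  have : ENNReal.HolderTriple 4 4 2 := ⟨by
    have : (4 : ℝ≥0∞) = 2 * 2 := by norm_num
    rw [this, ENNReal.mul_inv (by simp) (by simp), ← mul_add, ENNReal.inv_two_add_inv_two, mul_one]⟩
  exact hY.mul hX

lemma memLp_two_sum_sq {ι : Type*} [Fintype ι] {X : ι → Ω → ℝ} (hX : ∀ i, MemLp (X i) 4 P) :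
    MemLp (fun ω ↦ ∑ i, X i ω ^ 2) 2 P :=
  memLp_finsetSum _ fun i _ ↦ by simpa only [pow_two] using memLp_two_mul (hX i) (hX i)

lemma variance_sq_of_hasGaussianLaw {X : Ω → ℝ} (hX : HasGaussianLaw X P)
    (h0 : ∫ ω, X ω ∂P = 0) : Var[fun ω ↦ X ω ^ 2; P] = 2 * Var[X; P] ^ 2 := by
  have := hX.isProbabilityMeasure
  have h4 : MemLp X 4 P := hX.memLp (by simp)
  have h2 : Var[X; P] = ∫ ω, X ω ^ 2 ∂P := by
    rw [variance_of_integral_eq_zero hX.aemeasurable h0]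
  rw [variance_eq_sub (by simpa only [pow_two] using memLp_two_mul h4 h4)]
  have : ∫ ω, ((fun ω ↦ X ω ^ 2) ^ 2) ω ∂P = 3 * Var[X; P] ^ 2 := by
    rw [← integral_pow_four_of_hasGaussianLaw hX h0]
    congr with ω
    simp; ring
  rw [this, ← h2]
  ring

/-- Uncorrelated jointly Gaussian variables are independent, so that the variances of the squares
add up. -/
lemma variance_sum_sq_of_hasGaussianLaw {ι : Type*} [Fintype ι] {X : ι → Ω → ℝ}
    (hX : HasGaussianLaw (fun ω i ↦ X i ω) P) (h0 : ∀ i, ∫ ω, X i ω ∂P = 0)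
    (hcov : ∀ i j, i ≠ j → ∫ ω, X i ω * X j ω ∂P = 0) :
    Var[fun ω ↦ ∑ i, X i ω ^ 2; P] = 2 * ∑ i, (∫ ω, X i ω ^ 2 ∂P) ^ 2 := by
  have := hX.isProbabilityMeasure
  have hXi (i : ι) : HasGaussianLaw (X i) P := hX.eval i
  have h4 (i : ι) : MemLp (X i) 4 P := (hXi i).memLp (by simp)
  have hind : iIndepFun X P := hX.iIndepFun_of_covariance_eq_zero fun i j hij ↦ by
    rw [covariance_eq_sub (hXi i).memLp_two (hXi j).memLp_two, h0 i, zero_mul, sub_zero]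
    exact hcov i j hij
  have hsum : (fun ω ↦ ∑ i, X i ω ^ 2) = ∑ i, fun ω ↦ X i ω ^ 2 := by ext; simp
  rw [hsum, IndepFun.variance_sum, Finset.mul_sum]
  · refine Finset.sum_congr rfl fun i _ ↦ ?_
    rw [variance_sq_of_hasGaussianLaw (hXi i) (h0 i),
      variance_of_integral_eq_zero (hXi i).aemeasurable (h0 i)]
  · exact fun i _ ↦ by simpa only [pow_two] using memLp_two_mul (h4 i) (h4 i)
  · exact fun i _ j _ hij ↦ (hind.indepFun hij).comp (φ := fun x ↦ x ^ 2) (ψ := fun x ↦ x ^ 2)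
      (by fun_prop) (by fun_prop)

/-- The Cauchy-Schwarz inequality in `L²`. -/
lemma sq_integral_mul_le {X Y : Ω → ℝ} (hX : MemLp X 2 P) (hY : MemLp Y 2 P) :
    (∫ ω, X ω * Y ω ∂P) ^ 2 ≤ (∫ ω, X ω ^ 2 ∂P) * ∫ ω, Y ω ^ 2 ∂P := by
  have h (t : ℝ) : 0 ≤ (∫ ω, X ω ^ 2 ∂P) * (t * t) + (2 * ∫ ω, X ω * Y ω ∂P) * t +
      ∫ ω, Y ω ^ 2 ∂P := by
    have h0 : 0 ≤ ∫ ω, (t * X ω + Y ω) ^ 2 ∂P := integral_nonneg fun ω ↦ sq_nonneg _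
    have he (ω : Ω) : (t * X ω + Y ω) ^ 2 = t * t * X ω ^ 2 + 2 * t * (X ω * Y ω) + Y ω ^ 2 := by
      ring
    have hXY : Integrable (fun ω ↦ X ω * Y ω) P := hX.integrable_mul hY
    simp_rw [he] at h0
    have h1 : Integrable (fun ω ↦ t * t * X ω ^ 2) P := hX.integrable_sq.const_mul _
    have h2 : Integrable (fun ω ↦ 2 * t * (X ω * Y ω)) P := hXY.const_mul _
    have h3 : Integrable (fun ω ↦ t * t * X ω ^ 2 + 2 * t * (X ω * Y ω)) P := h1.add h2
    rw [integral_add h3 hY.integrable_sq, integral_add h1 h2, integral_const_mul,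
      integral_const_mul] at h0
    linarith
  have := discrim_le_zero h
  rw [discrim] at this
  linarith

/-- Cauchy-Schwarz for centred variables, as a reverse triangle inequality. -/
lemma sq_sqrt_variance_sub_le [IsProbabilityMeasure P] {A B : Ω → ℝ} (hA : MemLp A 2 P)
    (hB : MemLp B 2 P) :
    (√Var[A; P] - √Var[B; P]) ^ 2 ≤ Var[fun ω ↦ A ω - B ω; P] := by
  have h := sq_integral_mul_le (hA.sub (memLp_const (∫ ω, A ω ∂P)))
    (hB.sub (memLp_const (∫ ω, B ω ∂P)))
  have hcov : cov[A, B; P] ≤ √Var[A; P] * √Var[B; P] := by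
    rw [← Real.sqrt_mul (variance_nonneg _ _)]
    refine Real.le_sqrt_of_sq_le ?_
    rwa [variance_eq_integral hA.aemeasurable, variance_eq_integral hB.aemeasurable]
  have := variance_sub hA hB
  change _ ≤ Var[A - B; P]
  rw [this]
  nlinarith [Real.sq_sqrt (variance_nonneg A P), Real.sq_sqrt (variance_nonneg B P)]

/-- Nonnegativity of `E (∑ sᵢ Xᵢ - W)²` for orthogonal `Xᵢ`. -/
lemma sum_sq_sub_sum_add_nonneg {ι : Type*} [Fintype ι] {X : ι → Ω → ℝ} {W : Ω → ℝ}
    (hX : ∀ i, MemLp (X i) 2 P) (hW : MemLp W 2 P)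
    (hcov : ∀ i j, i ≠ j → ∫ ω, X i ω * X j ω ∂P = 0) (s : ι → ℝ) :
    0 ≤ ∑ i, s i ^ 2 * ∫ ω, X i ω ^ 2 ∂P - 2 * ∑ i, s i * ∫ ω, X i ω * W ω ∂P +
      ∫ ω, W ω ^ 2 ∂P := by
  classical
  have hXX (i j : ι) : Integrable (fun ω ↦ s i * s j * (X i ω * X j ω)) P :=
    ((hX i).integrable_mul (hX j)).const_mul _
  have hXW (i : ι) : Integrable (fun ω ↦ s i * (X i ω * W ω)) P :=
    ((hX i).integrable_mul hW).const_mul _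
  have he (ω : Ω) : (∑ i, s i * X i ω - W ω) ^ 2 =
      ∑ i, ∑ j, s i * s j * (X i ω * X j ω) - 2 * ∑ i, s i * (X i ω * W ω) + W ω ^ 2 := by
    have h1 : ∑ i, ∑ j, s i * s j * (X i ω * X j ω) = (∑ i, s i * X i ω) * ∑ i, s i * X i ω := by
      rw [Finset.sum_mul_sum]
      exact Finset.sum_congr rfl fun i _ ↦ Finset.sum_congr rfl fun j _ ↦ by ring
    have h2 : ∑ i, s i * (X i ω * W ω) = (∑ i, s i * X i ω) * W ω := by
      simp_rw [Finset.sum_mul, mul_assoc]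
    rw [h1, h2]
    ring
  have h0 : 0 ≤ ∫ ω, (∑ i, s i * X i ω - W ω) ^ 2 ∂P := integral_nonneg fun ω ↦ sq_nonneg _
  simp_rw [he] at h0
  rw [integral_add _ hW.integrable_sq, integral_sub _ ((integrable_finsetSum _
    fun i _ ↦ hXW i).const_mul 2), integral_const_mul, integral_finsetSum _ fun i _ ↦ hXW i,
    integral_finsetSum _ fun i _ ↦ integrable_finsetSum _ fun j _ ↦ hXX i j] at h0
  · simp_rw [integral_const_mul] at h0
    convert! h0 using 4 with i
    rw [integral_finsetSum _ fun j _ ↦ hXX i j, Finset.sum_eq_single i]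
    · simp_rw [integral_const_mul, pow_two]
    · intro j _ hj
      rw [integral_const_mul, hcov i j hj.symm, mul_zero]
    · simp
  · exact integrable_finsetSum _ fun i _ ↦ integrable_finsetSum _ fun j _ ↦ hXX i j
  · exact (integrable_finsetSum _ fun i _ ↦ integrable_finsetSum _ fun j _ ↦ hXX i j).sub
      ((integrable_finsetSum _ fun i _ ↦ hXW i).const_mul 2)

end Moments

/-! ### The distortion of a coupling -/

section Distortion

variable {Ω : Type*} [MeasurableSpace Ω] {P : Measure Ω}

/-- The second moment of the signed squared distance `∑ εₖ (Zₖ - Zₖ')²` between two independent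
copies of a centred random vector `Z`. The signs allow for the difference of two squared
distances. -/
lemma integrable_integral_signed_sq_dist [IsProbabilityMeasure P] {κ : Type*} [Fintype κ]
    (ε : κ → ℝ) {Z : κ → Ω → ℝ} (hZ : ∀ k, MemLp (Z k) 4 P) (h0 : ∀ k, ∫ ω, Z k ω ∂P = 0) :
    Integrable (fun w : Ω × Ω ↦ (∑ k, ε k * (Z k w.1 - Z k w.2) ^ 2) ^ 2) (P.prod P) ∧
    ∫ w, (∑ k, ε k * (Z k w.1 - Z k w.2) ^ 2) ^ 2 ∂(P.prod P) =
      2 * ∫ ω, (∑ k, ε k * Z k ω ^ 2) ^ 2 ∂P + 2 * (∫ ω, ∑ k, ε k * Z k ω ^ 2 ∂P) ^ 2 +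
      4 * ∑ k, ∑ l, ε k * ε l * (∫ ω, Z k ω * Z l ω ∂P) ^ 2 := by
  set p : Ω → ℝ := fun ω ↦ ∑ k, ε k * Z k ω ^ 2 with hp
  have hZ2 (k : κ) : MemLp (Z k) 2 P := (hZ k).mono_exponent (by norm_num)
  have hpL : MemLp p 2 P := memLp_finsetSum _ fun k _ ↦ by
    simpa only [pow_two] using (memLp_two_mul (hZ k) (hZ k)).const_mul (ε k)
  have hp1 : Integrable p P := hpL.integrable one_le_two
  have hp2 : Integrable (fun ω ↦ p ω ^ 2) P := hpL.integrable_sq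
  have hpZ (k : κ) : Integrable (fun ω ↦ p ω * Z k ω) P := hpL.integrable_mul (hZ2 k)
  have hZZ (k l : κ) : Integrable (fun ω ↦ Z k ω * Z l ω) P := (hZ2 k).integrable_mul (hZ2 l)
  have hZ1 (k : κ) : Integrable (Z k) P := (hZ2 k).integrable one_le_two
  have h1 : Integrable (fun _ : Ω ↦ (1 : ℝ)) P := integrable_const 1
  have i1 : Integrable (fun w : Ω × Ω ↦ p w.1 ^ 2 * 1) (P.prod P) := hp2.mul_prod h1
  have i2 : Integrable (fun w : Ω × Ω ↦ 1 * p w.2 ^ 2) (P.prod P) := h1.mul_prod hp2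
  have i3 : Integrable (fun w : Ω × Ω ↦ 2 * (p w.1 * p w.2)) (P.prod P) :=
    (hp1.mul_prod hp1).const_mul 2
  have i4 (k : κ) : Integrable (fun w : Ω × Ω ↦ 4 * ε k * (p w.1 * Z k w.1 * Z k w.2))
      (P.prod P) := ((hpZ k).mul_prod (hZ1 k)).const_mul _
  have i5 (k : κ) : Integrable (fun w : Ω × Ω ↦ 4 * ε k * (Z k w.1 * (p w.2 * Z k w.2)))
      (P.prod P) := ((hZ1 k).mul_prod (hpZ k)).const_mul _
  have i6 (k l : κ) : Integrable
      (fun w : Ω × Ω ↦ 4 * (ε k * ε l) * (Z k w.1 * Z l w.1 * (Z k w.2 * Z l w.2))) (P.prod P) :=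
    ((hZZ k l).mul_prod (hZZ k l)).const_mul _
  have j4 := integrable_finsetSum Finset.univ fun k _ ↦ i4 k
  have j5 := integrable_finsetSum Finset.univ fun k _ ↦ i5 k
  have j6' (k : κ) := integrable_finsetSum Finset.univ fun l _ ↦ i6 k l
  have j6 := integrable_finsetSum Finset.univ fun k _ ↦ j6' k
  have he (w : Ω × Ω) : (∑ k, ε k * (Z k w.1 - Z k w.2) ^ 2) ^ 2 =
      p w.1 ^ 2 * 1 + 1 * p w.2 ^ 2 + 2 * (p w.1 * p w.2)
      - ∑ k, 4 * ε k * (p w.1 * Z k w.1 * Z k w.2)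
      - ∑ k, 4 * ε k * (Z k w.1 * (p w.2 * Z k w.2))
      + ∑ k, ∑ l, 4 * (ε k * ε l) * (Z k w.1 * Z l w.1 * (Z k w.2 * Z l w.2)) := by
    -- the left side is `(p + p' - 2 q)²`
    set q : ℝ := ∑ k, ε k * (Z k w.1 * Z k w.2) with hq
    have e0 : ∑ k, ε k * (Z k w.1 - Z k w.2) ^ 2 = p w.1 + p w.2 - 2 * q := by
      simp only [hp, hq, Finset.mul_sum]
      rw [← Finset.sum_add_distrib, ← Finset.sum_sub_distrib]
      exact Finset.sum_congr rfl fun k _ ↦ by ring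
    have e4 : ∑ k, 4 * ε k * (p w.1 * Z k w.1 * Z k w.2) = 4 * p w.1 * q := by
      rw [hq, Finset.mul_sum]
      exact Finset.sum_congr rfl fun k _ ↦ by ring
    have e5 : ∑ k, 4 * ε k * (Z k w.1 * (p w.2 * Z k w.2)) = 4 * p w.2 * q := by
      rw [hq, Finset.mul_sum]
      exact Finset.sum_congr rfl fun k _ ↦ by ring
    have e6 : ∑ k, ∑ l, 4 * (ε k * ε l) * (Z k w.1 * Z l w.1 * (Z k w.2 * Z l w.2)) =
        4 * (q * q) := by
      rw [hq, Finset.sum_mul_sum, Finset.mul_sum]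
      refine Finset.sum_congr rfl fun k _ ↦ ?_
      rw [Finset.mul_sum]
      exact Finset.sum_congr rfl fun l _ ↦ by ring
    rw [e0, e4, e5, e6]
    ring
  -- the terms of odd degree in one of the two copies vanish
  have t4 (k : κ) : ∫ w, 4 * ε k * (p w.1 * Z k w.1 * Z k w.2) ∂(P.prod P) = 0 := by
    rw [integral_const_mul, integral_prod_mul (fun ω ↦ p ω * Z k ω) (Z k), h0 k]
    ring
  have t5 (k : κ) : ∫ w, 4 * ε k * (Z k w.1 * (p w.2 * Z k w.2)) ∂(P.prod P) = 0 := by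
    rw [integral_const_mul, integral_prod_mul (Z k) (fun ω ↦ p ω * Z k ω), h0 k]
    ring
  have t6 (k l : κ) :
      ∫ w, 4 * (ε k * ε l) * (Z k w.1 * Z l w.1 * (Z k w.2 * Z l w.2)) ∂(P.prod P) =
      4 * (ε k * ε l * (∫ ω, Z k ω * Z l ω ∂P) ^ 2) := by
    rw [integral_const_mul, integral_prod_mul (fun ω ↦ Z k ω * Z l ω) (fun ω ↦ Z k ω * Z l ω)]
    ring
  have k3 := (i1.add i2).add i3
  simp_rw [he]
  refine ⟨((k3.sub j4).sub j5).add j6, ?_⟩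
  rw [integral_add _ j6, integral_sub _ j5, integral_sub _ j4,
    integral_add _ i3, integral_add i1 i2,
    integral_finsetSum _ fun k _ ↦ i4 k, integral_finsetSum _ fun k _ ↦ i5 k,
    integral_finsetSum _ fun k _ ↦ j6' k, integral_prod_mul (fun ω ↦ p ω ^ 2) (fun _ ↦ (1 : ℝ)),
    integral_prod_mul (fun _ ↦ (1 : ℝ)) (fun ω ↦ p ω ^ 2), integral_const_mul,
    integral_prod_mul p p]
  simp_rw [t4, t5, integral_finsetSum _ fun l _ ↦ i6 _ l, t6, Finset.mul_sum]
  · simp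
    ring
  exacts [i1.add i2, k3, k3.sub j4, (k3.sub j4).sub j5]

/-- The distortion bound for jointly distributed centred Gaussian vectors with diagonal covariances.
No joint law is prescribed: only the two marginals are Gaussian. -/
lemma le_integral_distortion {m n : ℕ} (hnm : n ≤ m) {X : Fin m → Ω → ℝ} {Y : Fin n → Ω → ℝ}
    (hX : HasGaussianLaw (fun ω i ↦ X i ω) P) (hY : HasGaussianLaw (fun ω j ↦ Y j ω) P)
    (hX0 : ∀ i, ∫ ω, X i ω ∂P = 0) (hY0 : ∀ j, ∫ ω, Y j ω ∂P = 0)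
    {a : Fin m → ℝ} {b : Fin n → ℝ} (ha : Antitone a) (hb : Antitone b)
    (hXX : ∀ i k, ∫ ω, X i ω * X k ω ∂P = Matrix.diagonal a i k)
    (hYY : ∀ j l, ∫ ω, Y j ω * Y l ω ∂P = Matrix.diagonal b j l) :
    Integrable (fun w : Ω × Ω ↦
      (∑ i, (X i w.1 - X i w.2) ^ 2 - ∑ j, (Y j w.1 - Y j w.2) ^ 2) ^ 2) (P.prod P) ∧
    4 * (∑ i, a i - ∑ j, b j) ^ 2 + 4 * (√(∑ i, a i ^ 2) - √(∑ j, b j ^ 2)) ^ 2 +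
      4 * (∑ i, a i ^ 2 + ∑ j, b j ^ 2 - 2 * ∑ j, a (Fin.castLE hnm j) * b j) ≤
    ∫ w, (∑ i, (X i w.1 - X i w.2) ^ 2 - ∑ j, (Y j w.1 - Y j w.2) ^ 2) ^ 2 ∂(P.prod P) := by
  have := hX.isProbabilityMeasure
  have hX4 (i : Fin m) : MemLp (X i) 4 P := (hX.eval i).memLp (by simp)
  have hY4 (j : Fin n) : MemLp (Y j) 4 P := (hY.eval j).memLp (by simp)
  have hX2 (i : Fin m) : MemLp (X i) 2 P := (hX.eval i).memLp_two
  have hY2 (j : Fin n) : MemLp (Y j) 2 P := (hY.eval j).memLp_two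
  have hXsq (i : Fin m) : ∫ ω, X i ω ^ 2 ∂P = a i := by simpa [pow_two] using hXX i i
  have hYsq (j : Fin n) : ∫ ω, Y j ω ^ 2 ∂P = b j := by simpa [pow_two] using hYY j j
  have hXo (i k : Fin m) (h : i ≠ k) : ∫ ω, X i ω * X k ω ∂P = 0 := by rw [hXX]; simp [h]
  have hYo (j l : Fin n) (h : j ≠ l) : ∫ ω, Y j ω * Y l ω ∂P = 0 := by rw [hYY]; simp [h]
  have ha0 (i : Fin m) : 0 ≤ a i := hXsq i ▸ integral_nonneg fun ω ↦ sq_nonneg _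
  have hb0 (j : Fin n) : 0 ≤ b j := hYsq j ▸ integral_nonneg fun ω ↦ sq_nonneg _
  have hK : ∑ i, ∑ j, (∫ ω, X i ω * Y j ω ∂P) ^ 2 ≤ ∑ j, a (Fin.castLE hnm j) * b j := by
    refine sum_sq_crossCov_le hnm ha hb ha0 hb0 (fun i j ↦ ?_) (fun i t ↦ ?_) (fun j s ↦ ?_)
    · simpa only [hXsq, hYsq] using sq_integral_mul_le (hX2 i) (hY2 j)
    · simpa only [hXsq, hYsq, mul_comm (Y _ _) (X _ _)] using
        sum_sq_sub_sum_add_nonneg hY2 (hX2 i) hYo t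
    · simpa only [hXsq, hYsq] using sum_sq_sub_sum_add_nonneg hX2 (hY2 j) hXo s
  have hA : MemLp (fun ω ↦ ∑ i, X i ω ^ 2) 2 P := memLp_two_sum_sq hX4
  have hB : MemLp (fun ω ↦ ∑ j, Y j ω ^ 2) 2 P := memLp_two_sum_sq hY4
  have hEA : ∫ ω, ∑ i, X i ω ^ 2 ∂P = ∑ i, a i := by
    rw [integral_finsetSum _ fun i _ ↦ (hX2 i).integrable_sq]
    simp_rw [hXsq]
  have hEB : ∫ ω, ∑ j, Y j ω ^ 2 ∂P = ∑ j, b j := by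
    rw [integral_finsetSum _ fun j _ ↦ (hY2 j).integrable_sq]
    simp_rw [hYsq]
  have hVA : Var[fun ω ↦ ∑ i, X i ω ^ 2; P] = 2 * ∑ i, a i ^ 2 := by
    rw [variance_sum_sq_of_hasGaussianLaw hX hX0 hXo]
    simp_rw [hXsq]
  have hVB : Var[fun ω ↦ ∑ j, Y j ω ^ 2; P] = 2 * ∑ j, b j ^ 2 := by
    rw [variance_sum_sq_of_hasGaussianLaw hY hY0 hYo]
    simp_rw [hYsq]
  have hEp : ∫ ω, (∑ i, X i ω ^ 2 - ∑ j, Y j ω ^ 2) ∂P = ∑ i, a i - ∑ j, b j := by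
    rw [integral_sub (hA.integrable one_le_two) (hB.integrable one_le_two), hEA, hEB]
  have hAB : MemLp (fun ω ↦ ∑ i, X i ω ^ 2 - ∑ j, Y j ω ^ 2) 2 P := hA.sub hB
  have hVp := sq_sqrt_variance_sub_le hA hB
  rw [variance_eq_sub hAB, hVA, hVB, hEp, Real.sqrt_mul (by norm_num),
    Real.sqrt_mul (by norm_num), ← mul_sub, mul_pow, Real.sq_sqrt (by norm_num)] at hVp
  obtain ⟨hint, heq⟩ := integrable_integral_signed_sq_dist (P := P)
    (Sum.elim (fun _ : Fin m ↦ (1 : ℝ)) (fun _ : Fin n ↦ -1)) (Z := Sum.elim X Y)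
    (by rintro (i | j) <;> simp [hX4, hY4]) (by rintro (i | j) <;> simp [hX0, hY0])
  have hdX : ∑ i, ∑ k, (∫ ω, X i ω * X k ω ∂P) ^ 2 = ∑ i, a i ^ 2 := by
    refine Finset.sum_congr rfl fun i _ ↦ ?_
    rw [Finset.sum_eq_single i (fun k _ hk ↦ by simp [hXo i k hk.symm]) (by simp), hXX]
    simp
  have hdY : ∑ j, ∑ l, (∫ ω, Y j ω * Y l ω ∂P) ^ 2 = ∑ j, b j ^ 2 := by
    refine Finset.sum_congr rfl fun j _ ↦ ?_
    rw [Finset.sum_eq_single j (fun k _ hk ↦ by simp [hYo j k hk.symm]) (by simp), hYY]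
    simp
  have hYX : ∑ j, ∑ i, (∫ ω, Y j ω * X i ω ∂P) ^ 2 = ∑ i, ∑ j, (∫ ω, X i ω * Y j ω ∂P) ^ 2 := by
    rw [Finset.sum_comm]
    simp_rw [mul_comm (Y _ _)]
  simp only [Fintype.sum_sum_type, Sum.elim_inl, Sum.elim_inr, one_mul, neg_mul, mul_neg,
    Finset.sum_neg_distrib, ← sub_eq_add_neg, Finset.sum_sub_distrib,
    hdX, hdY, hYX, hEp] at hint heq
  refine ⟨hint, ?_⟩
  rw [heq]
  simp only [Pi.pow_apply] at hVp
  linarith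

end Distortion

/-! ### Gaussian vectors in an eigenbasis of the covariance -/

section Coordinates

variable {k : ℕ} {S P D : Matrix (Fin k) (Fin k) ℝ}

/-- The `i`-th coordinate of `x - c` in the basis given by the columns of `P`. -/
noncomputable def eigenCoord (P : Matrix (Fin k) (Fin k) ℝ) (c x : EuclideanSpace ℝ (Fin k))
    (i : Fin k) : ℝ := inner ℝ (WithLp.toLp 2 (P.col i)) (x - c)

lemma eigenCoord_sub (c x x' : EuclideanSpace ℝ (Fin k)) (i : Fin k) :
    eigenCoord P c x i - eigenCoord P c x' i = (Pᵀ *ᵥ (x - x').ofLp) i := by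
  rw [eigenCoord, eigenCoord, ← inner_sub_right, sub_sub_sub_cancel_right]
  simp only [PiLp.inner_apply, mulVec, dotProduct, Matrix.col_apply, transpose_apply]
  exact Finset.sum_congr rfl fun l _ ↦ by simp [mul_comm]

/-- Passing to coordinates in an orthonormal basis is an isometry. -/
lemma sum_sq_eigenCoord_sub (hP : P ∈ Matrix.orthogonalGroup (Fin k) ℝ)
    (c x x' : EuclideanSpace ℝ (Fin k)) :
    ∑ i, (eigenCoord P c x i - eigenCoord P c x' i) ^ 2 = ‖x - x'‖ ^ 2 := by
  have h : (Pᵀ *ᵥ (x - x').ofLp) ⬝ᵥ (Pᵀ *ᵥ (x - x').ofLp) = (x - x').ofLp ⬝ᵥ (x - x').ofLp := by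
    rw [dotProduct_mulVec, vecMul_transpose, mulVec_mulVec,
      (Matrix.mem_orthogonalGroup_iff _ _).1 hP, one_mulVec]
  rw [EuclideanSpace.real_norm_sq_eq]
  simp_rw [eigenCoord_sub, pow_two]
  exact h

variable {Ω : Type*} [MeasurableSpace Ω] {π : Measure Ω} {c : EuclideanSpace ℝ (Fin k)}
  {T : Ω → EuclideanSpace ℝ (Fin k)}

lemma hasGaussianLaw_eigenCoord (hT : Measurable T) (hπ : π.map T = multivariateGaussian c S) :
    HasGaussianLaw (fun ω i ↦ eigenCoord P c (T ω) i) π := by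
  have h : HasGaussianLaw (fun ω ↦ T ω - c) π := ⟨by
    have : π.map (fun ω ↦ T ω - c) = (multivariateGaussian c S).map (fun x ↦ x - c) := by
      rw [← hπ, Measure.map_map (by fun_prop) hT]
      rfl
    rw [this]
    infer_instance⟩
  exact h.map_fun (ContinuousLinearMap.pi fun i ↦ innerSL ℝ (WithLp.toLp 2 (P.col i)))

lemma integral_eigenCoord (hT : Measurable T) (hπ : π.map T = multivariateGaussian c S)
    (i : Fin k) : ∫ ω, eigenCoord P c (T ω) i ∂π = 0 := by
  have hm : AEStronglyMeasurable (fun x ↦ eigenCoord P c x i) (π.map T) := by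
    unfold eigenCoord
    exact Continuous.aestronglyMeasurable (by fun_prop)
  rw [← integral_map hT.aemeasurable hm, hπ]
  have hI : Integrable (fun x ↦ x) (multivariateGaussian c S) := IsGaussian.integrable_fun_id
  have hIc : Integrable (fun x ↦ x - c) (multivariateGaussian c S) := hI.sub (integrable_const c)
  simp only [eigenCoord]
  rw [integral_inner hIc, integral_sub hI (integrable_const c)]
  simp

lemma IsSortedDiagonalization.diagonal_diag (h : IsSortedDiagonalization S P D) :
    Matrix.diagonal (fun i ↦ D i i) = D := h.isDiag.diagonal_diag

/-- In an eigenbasis the covariance becomes `Pᵀ * S * P = D`. -/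
lemma integral_eigenCoord_mul (hS : S.PosSemidef) (h : IsSortedDiagonalization S P D)
    (hT : Measurable T) (hπ : π.map T = multivariateGaussian c S) (i j : Fin k) :
    ∫ ω, eigenCoord P c (T ω) i * eigenCoord P c (T ω) j ∂π =
      Matrix.diagonal (fun i ↦ D i i) i j := by
  have hm : AEStronglyMeasurable (fun x ↦ eigenCoord P c x i * eigenCoord P c x j) (π.map T) := by
    unfold eigenCoord
    exact Continuous.aestronglyMeasurable (by fun_prop)
  rw [← integral_map hT.aemeasurable hm, hπ, h.diagonal_diag]
  have hPtP : Pᵀ * P = 1 := (Matrix.mem_orthogonalGroup_iff' _ _).1 h.orthogonal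
  have hD : Pᵀ * S * P = D := by
    rw [h.eq]
    calc Pᵀ * (P * D * Pᵀ) * P = (Pᵀ * P) * D * (Pᵀ * P) := by simp only [Matrix.mul_assoc]
      _ = D := by simp [hPtP]
  have hcov := covarianceBilin_apply (μ := multivariateGaussian c S) IsGaussian.memLp_two_id
    (WithLp.toLp 2 (P.col i)) (WithLp.toLp 2 (P.col j))
  rw [integral_id_multivariateGaussian', covarianceBilin_multivariateGaussian hS] at hcov
  simp only [eigenCoord]
  rw [← hcov]
  conv_rhs => rw [← hD]
  rw [Matrix.mul_assoc, Matrix.mul_apply]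
  rfl

end Coordinates

/-! ### Frobenius norms of diagonal matrices -/

lemma frobNorm_diagonal {k : ℕ} (d : Fin k → ℝ) :
    frobNorm (Matrix.diagonal d) = √(∑ i, d i ^ 2) := by
  simp [frobNorm, pow_two]

lemma leading_diagonal {m n : ℕ} (hnm : n ≤ m) (d : Fin m → ℝ) :
    leading hnm (Matrix.diagonal d) = Matrix.diagonal fun j ↦ d (Fin.castLE hnm j) :=
  submatrix_diagonal _ _ (Fin.castLE_injective hnm)

lemma LGW₂sq_diagonal {m n : ℕ} (hnm : n ≤ m) (a : Fin m → ℝ) (b : Fin n → ℝ) :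
    LGW₂sq hnm (Matrix.diagonal a) (Matrix.diagonal b) =
      4 * (∑ i, a i - ∑ j, b j) ^ 2 + 4 * (√(∑ i, a i ^ 2) - √(∑ j, b j ^ 2)) ^ 2 +
      4 * (∑ i, a i ^ 2 + ∑ j, b j ^ 2 - 2 * ∑ j, a (Fin.castLE hnm j) * b j) := by
  have hsq {k : ℕ} (d : Fin k → ℝ) : √(∑ i, d i ^ 2) ^ 2 = ∑ i, d i ^ 2 :=
    Real.sq_sqrt (Finset.sum_nonneg fun i _ ↦ sq_nonneg _)
  rw [LGW₂sq, leading_diagonal, Matrix.diagonal_sub]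
  simp only [frobNorm_diagonal, hsq, Matrix.trace_diagonal]
  simp only [sub_sq, Finset.sum_add_distrib, Finset.sum_sub_distrib, mul_assoc, ← Finset.mul_sum]
  ring

/-! ### The lower bound for every coupling -/

lemma ofReal_LGW₂sq_le_lintegral_of_mem_couplings {m n : ℕ} (hnm : n ≤ m)
    {m₀ : EuclideanSpace ℝ (Fin m)} {m₁ : EuclideanSpace ℝ (Fin n)}
    {S₀ P₀ D₀ : Matrix (Fin m) (Fin m) ℝ} {S₁ P₁ D₁ : Matrix (Fin n) (Fin n) ℝ}
    (hS₀ : S₀.PosSemidef) (hS₁ : S₁.PosSemidef)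
    (h₀ : IsSortedDiagonalization S₀ P₀ D₀) (h₁ : IsSortedDiagonalization S₁ P₁ D₁)
    {π : Measure (EuclideanSpace ℝ (Fin m) × EuclideanSpace ℝ (Fin n))}
    (hπ : π ∈ couplings (multivariateGaussian m₀ S₀) (multivariateGaussian m₁ S₁)) :
    ENNReal.ofReal (LGW₂sq hnm D₀ D₁) ≤
      ∫⁻ z, ∫⁻ z', ENNReal.ofReal (|‖z.1 - z'.1‖ ^ 2 - ‖z.2 - z'.2‖ ^ 2| ^ (2 : ℝ)) ∂π ∂π := by
  have hX := hasGaussianLaw_eigenCoord (P := P₀) measurable_fst hπ.1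
  have hY := hasGaussianLaw_eigenCoord (P := P₁) measurable_snd hπ.2
  have := hX.isProbabilityMeasure
  obtain ⟨hint, hle⟩ := le_integral_distortion hnm hX hY
    (integral_eigenCoord measurable_fst hπ.1) (integral_eigenCoord measurable_snd hπ.2)
    h₀.sorted h₁.sorted (integral_eigenCoord_mul hS₀ h₀ measurable_fst hπ.1)
    (integral_eigenCoord_mul hS₁ h₁ measurable_snd hπ.2)
  rw [← LGW₂sq_diagonal, h₀.diagonal_diag, h₁.diagonal_diag] at hle
  simp_rw [sum_sq_eigenCoord_sub h₀.orthogonal, sum_sq_eigenCoord_sub h₁.orthogonal] at hint hle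
  refine (ENNReal.ofReal_le_ofReal hle).trans_eq ?_
  rw [ofReal_integral_eq_lintegral_ofReal hint (ae_of_all _ fun w ↦ sq_nonneg _),
    lintegral_prod _ hint.aemeasurable.ennreal_ofReal]
  simp only [Real.rpow_two, sq_abs]

end GromovGaussian

theorem mainTheorem2 {m n : ℕ} (hnm : n ≤ m)
    (m₀ : EuclideanSpace ℝ (Fin m)) (m₁ : EuclideanSpace ℝ (Fin n))
    (S₀ P₀ D₀ : Matrix (Fin m) (Fin m) ℝ) (S₁ P₁ D₁ : Matrix (Fin n) (Fin n) ℝ)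
    (hS₀ : S₀.PosSemidef) (hS₁ : S₁.PosSemidef) (hdet : S₀.det ≠ 0)
    (h₀ : GromovGaussian.IsSortedDiagonalization S₀ P₀ D₀)
    (h₁ : GromovGaussian.IsSortedDiagonalization S₁ P₁ D₁) :
    ENNReal.ofReal (GromovGaussian.LGW₂sq hnm D₀ D₁) ≤
      GromovGaussian.GW₂ (multivariateGaussian m₀ S₀) (multivariateGaussian m₁ S₁) ^ 2 := by
  rw [GromovGaussian.GW₂, GromovGaussian.gromovWasserstein, ← ENNReal.rpow_natCast,
    ← ENNReal.rpow_mul]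
  simp only [Nat.cast_ofNat, one_div, inv_mul_cancel₀ (two_ne_zero' ℝ), ENNReal.rpow_one]
  exact le_iInf₂ fun π hπ ↦
    GromovGaussian.ofReal_LGW₂sq_le_lintegral_of_mem_couplings hnm hS₀ hS₁ h₀ h₁ hπ
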